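/- **Conventions.** A cover of a set $X$ is a family of subsets of $X$ with union $X$; $\mathcal U\prec\mathcal V$ ($\mathcal U$ refines $\mathcal V$) means that every member of $\mathcal U$ is contained in a member of $\mathcal V$; and $\mathcal U\restriction A=\{U\cap A:U\in\mathcal U\}$. A *pre-uniformity* on $X$ is a non-empty set $\mu$ of covers of $X$ such that $\mathcal V\in\mu$ whenever $\mathcal U\in\mu$ and $\mathcal U\prec\mathcal V$, and $\{U\cap V:U\in\mathcal U,\,V\in\mathcal V\}\in\mu$ whenever $\mathcal U,\mathcal V\in\mu$. A pre-uniformity on a topological space is *supercomplete* if it contains every open cover of the space. - For pre-uniformities $\mu_i$ on $X_i$, the product $\Pi\mu_i$ is the pre-uniformity on $\Pi X_i$ generated by the covers $\{\pi_i^{-1}[U]:U\in\mathcal U\}$, where $\mathcal U\in\mu_i$. - For a pre-uniformity $\mu$ on a topological space $X$, the metric-fine modification $m\mu$ is the set of all covers refined by some cover $\mathcal V$ of $X$ for which there is a countable closed cover $\{F_n:n\in\mathbb N\}$ of $X$ such that for each $n$ there is $\mathcal U_n\in\mu$ with $\mathcal U_n\restriction F_n\prec\mathcal V\restriction F_n$.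 - For a pre-uniformity $\mu$, the locally fine coreflection $\lambda\mu$ is the smallest pre-uniformity $\nu\supseteq\mu$ that is locally fine, i.e. such that $\{U\cap V:U\in\mathcal U,\,V\in\mathcal V_U\}\in\nu$ whenever $\mathcal U\in\nu$ and $\mathcal V_U\in\nu$ for all $U\in\mathcal U$. A *left-open partition* of a space $X$ is a partition $\mathcal P$ of $X$ together with a well-ordering of $\mathcal P$ such that $\bigcup\{Q\in\mathcal P:Q\le P\}$ is open for every $P\in\mathcal P$. A sequence $(\mathcal P_n)_{n\in\mathbb N}$ of left-open partitions is *complete* if, for all $n$, $\mathcal P_{n+1}$ refines $\mathcal P_n$; for all $n$, if $P,P'\in\mathcal P_n$, $Q,Q'\in\mathcal P_{n+1}$, $Q\subset P$, $Q'\subset P'$ and $Q\le Q'$, then $P\le P'$; and every (proper) filter on $X$ that contains a member of each $\mathcal P_n$ has a cluster point. A space is *partition-complete* if it has a complete sequence of left-open partitions, and *$\sigma$-partition-complete* if it is the union of countably many closed subspaces each of which is partition-complete. **Theorem 6.4 (Theorem A).** Let $(X_i:i\in\mathbb N)$ be a countable family of $\sigma$-partition-complete regular topological spaces, and for each $i$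 let $\mu_i$ be a supercomplete pre-uniformity on $X_i$. Then $\lambda m\Pi\mu_i$ is a supercomplete pre-uniformity for the topological product $\Pi X_i$; that is, every open cover of $\Pi X_i$ belongs to $\lambda m\Pi\mu_i$. -/

import Mathlib

open Set

/-- `Refines U V` (written `U ≺ V`): every member of `U` is contained in a member of `V`. -/
def Refines {X : Type*} (U V : Set (Set X)) : Prop :=
  ∀ u ∈ U, ∃ v ∈ V, u ⊆ v

/-- The restriction `U ↾ A = {u ∩ A : u ∈ U}` of a family of sets to a subset `A`. -/
def traceOn {X : Type*} (U : Set (Set X)) (A : Set X) : Set (Set X) :=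
  (fun u => u ∩ A) '' U

/-- The family of all sets `u ∩ v` with `u ∈ U` and `v ∈ V u`. -/
def subdivide {X : Type*} (U : Set (Set X)) (V : Set X → Set (Set X)) : Set (Set X) :=
  {w | ∃ u ∈ U, ∃ v ∈ V u, w = u ∩ v}

/-- A pre-uniformity on a set: a filter of coverings, with respect to refinement. -/
structure PreUniformity (X : Type*) where
  covers : Set (Set (Set X))
  isCover : ∀ U ∈ covers, ⋃₀ U = univ
  nonempty : covers.Nonempty
  of_refines : ∀ U ∈ covers, ∀ V, Refines U V → V ∈ covers
  inter_mem : ∀ U ∈ covers, ∀ V ∈ covers, image2 (· ∩ ·) U V ∈ covers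

namespace PreUniformity

variable {X : Type*}

theorem univ_mem (μ : PreUniformity X) : {univ} ∈ μ.covers := by
  obtain ⟨U, hU⟩ := μ.nonempty
  exact μ.of_refines U hU _ fun u _ => ⟨univ, rfl, subset_univ u⟩

theorem isCover_of_refines {U V : Set (Set X)} (hU : ⋃₀ U = univ) (h : Refines U V) :
    ⋃₀ V = univ := by
  refine eq_univ_of_forall fun x => ?_
  obtain ⟨u, hu, hx⟩ : x ∈ ⋃₀ U := hU ▸ mem_univ x
  obtain ⟨v, hv, huv⟩ := h u hu
  exact ⟨v, hv, huv hx⟩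

theorem isCover_inter {U V : Set (Set X)} (hU : ⋃₀ U = univ) (hV : ⋃₀ V = univ) :
    ⋃₀ image2 (· ∩ ·) U V = univ := by
  refine eq_univ_of_forall fun x => ?_
  obtain ⟨u, hu, hxu⟩ : x ∈ ⋃₀ U := hU ▸ mem_univ x
  obtain ⟨v, hv, hxv⟩ : x ∈ ⋃₀ V := hV ▸ mem_univ x
  exact ⟨u ∩ v, ⟨u, hu, v, hv, rfl⟩, hxu, hxv⟩

/-- The least pre-uniformity that contains a given set `S` of coverings. -/
def generate (S : Set (Set (Set X))) : PreUniformity X where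
  covers := {W | ⋃₀ W = univ ∧ ∀ ν : PreUniformity X, S ⊆ ν.covers → W ∈ ν.covers}
  isCover _ hW := hW.1
  nonempty := ⟨{univ}, sUnion_singleton _, fun ν _ => ν.univ_mem⟩
  of_refines U hU V h :=
    ⟨isCover_of_refines hU.1 h, fun ν hν => ν.of_refines U (hU.2 ν hν) V h⟩
  inter_mem U hU V hV :=
    ⟨isCover_inter hU.1 hV.1, fun ν hν => ν.inter_mem U (hU.2 ν hν) V (hV.2 ν hν)⟩

/-- The product pre-uniformity: generated by the inverse images, under the projections, of the
members of the pre-uniformities of the factors. -/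
def pi {ι : Type*} {X : ι → Type*} (μ : ∀ i, PreUniformity (X i)) :
    PreUniformity (∀ i, X i) :=
  generate {W | ∃ i, ∃ U ∈ (μ i).covers, W = (fun u => (fun x : ∀ i, X i => x i) ⁻¹' u) '' U}

/-- `ν` is locally fine, i.e. closed under `ν ↦ ν / ν`: subdividing the members of a `ν`-cover by
`ν`-covers, a separate one for each member, gives a `ν`-cover. -/
def IsLocallyFine (ν : PreUniformity X) : Prop :=
  ∀ U ∈ ν.covers, ∀ V : Set X → Set (Set X), (∀ u ∈ U, V u ∈ ν.covers) →
    subdivide U V ∈ ν.covers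

/-- The locally fine coreflection `λ μ`: the least locally fine pre-uniformity finer than `μ`. -/
def locallyFine (μ : PreUniformity X) : PreUniformity X where
  covers := {W | ⋃₀ W = univ ∧
    ∀ ν : PreUniformity X, μ.covers ⊆ ν.covers → ν.IsLocallyFine → W ∈ ν.covers}
  isCover _ hW := hW.1
  nonempty := ⟨{univ}, sUnion_singleton _, fun ν _ _ => ν.univ_mem⟩
  of_refines U hU V h :=
    ⟨isCover_of_refines hU.1 h, fun ν h₁ h₂ => ν.of_refines U (hU.2 ν h₁ h₂) V h⟩
  inter_mem U hU V hV :=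
    ⟨isCover_inter hU.1 hV.1, fun ν h₁ h₂ =>
      ν.inter_mem U (hU.2 ν h₁ h₂) V (hV.2 ν h₁ h₂)⟩

theorem le_locallyFine (μ : PreUniformity X) : μ.covers ⊆ μ.locallyFine.covers :=
  fun W hW => ⟨μ.isCover W hW, fun _ h _ => h hW⟩

theorem isLocallyFine_locallyFine (μ : PreUniformity X) : μ.locallyFine.IsLocallyFine := by
  intro U hU V hV
  refine ⟨eq_univ_of_forall fun x => ?_, fun ν h₁ h₂ =>
    h₂ U (hU.2 ν h₁ h₂) V fun u hu => (hV u hu).2 ν h₁ h₂⟩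
  obtain ⟨u, hu, hxu⟩ : x ∈ ⋃₀ U := hU.1 ▸ mem_univ x
  obtain ⟨v, hv, hxv⟩ : x ∈ ⋃₀ V u := (hV u hu).1 ▸ mem_univ x
  exact ⟨u ∩ v, ⟨u, hu, v, hv, rfl⟩, hxu, hxv⟩

/-- The metric-fine modification `m μ` of a pre-uniformity on a topological space: all covers
refined by a cover `V` for which there is a countable closed cover `F n` of the space such that on
each `F n` the trace of `V` is refined by the trace of some member of `μ`. -/
def metricFine [TopologicalSpace X] (μ : PreUniformity X) : PreUniformity X where
  covers := {W | ∃ V : Set (Set X), ⋃₀ V = univ ∧ Refines V W ∧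
    ∃ F : ℕ → Set X, (∀ n, IsClosed (F n)) ∧ ⋃ n, F n = univ ∧
      ∀ n, ∃ U ∈ μ.covers, Refines (traceOn U (F n)) (traceOn V (F n))}
  isCover := by
    rintro W ⟨V, hV, h, -⟩
    exact isCover_of_refines hV h
  nonempty := ⟨{univ}, {univ}, sUnion_singleton _, fun u hu => ⟨u, hu, Subset.rfl⟩,
    fun _ => univ, fun _ => isClosed_univ, iUnion_const _, fun _ =>
      ⟨{univ}, μ.univ_mem, fun u hu => ⟨u, hu, Subset.rfl⟩⟩⟩
  of_refines := by
    rintro W ⟨V, hV, h, hF⟩ W' h'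
    refine ⟨V, hV, fun v hv => ?_, hF⟩
    obtain ⟨w, hw, hvw⟩ := h v hv
    obtain ⟨w', hw', hww'⟩ := h' w hw
    exact ⟨w', hw', hvw.trans hww'⟩
  inter_mem := by
    rintro W ⟨V, hV, h, F, hF, hFu, hU⟩ W' ⟨V', hV', h', F', hF', hFu', hU'⟩
    refine ⟨image2 (· ∩ ·) V V', isCover_inter hV hV', ?_,
      fun n => F n.unpair.1 ∩ F' n.unpair.2, fun n => (hF _).inter (hF' _), ?_, fun n => ?_⟩
    · rintro _ ⟨v, hv, v', hv', rfl⟩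
      obtain ⟨w, hw, hvw⟩ := h v hv
      obtain ⟨w', hw', hvw'⟩ := h' v' hv'
      exact ⟨w ∩ w', ⟨w, hw, w', hw', rfl⟩, inter_subset_inter hvw hvw'⟩
    · refine eq_univ_of_forall fun x => ?_
      obtain ⟨a, ha⟩ := mem_iUnion.1 (hFu ▸ mem_univ x : x ∈ ⋃ n, F n)
      obtain ⟨b, hb⟩ := mem_iUnion.1 (hFu' ▸ mem_univ x : x ∈ ⋃ n, F' n)
      exact mem_iUnion.2 ⟨Nat.pair a b, by simpa using ⟨ha, hb⟩⟩
    · obtain ⟨U, hUm, hUr⟩ := hU n.unpair.1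
      obtain ⟨U', hUm', hUr'⟩ := hU' n.unpair.2
      refine ⟨_, μ.inter_mem U hUm U' hUm', ?_⟩
      rintro _ ⟨_, ⟨u, hu, u', hu', rfl⟩, rfl⟩
      obtain ⟨_, ⟨v, hv, rfl⟩, hs⟩ := hUr _ ⟨u, hu, rfl⟩
      obtain ⟨_, ⟨v', hv', rfl⟩, hs'⟩ := hUr' _ ⟨u', hu', rfl⟩
      refine ⟨_, ⟨_, ⟨v, hv, v', hv', rfl⟩, rfl⟩, ?_⟩
      rintro x ⟨⟨hxu, hxu'⟩, hxF, hxF'⟩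
      exact ⟨⟨(hs ⟨hxu, hxF⟩).1, (hs' ⟨hxu', hxF'⟩).1⟩, hxF, hxF'⟩

/-- A pre-uniformity on a topological space is supercomplete if it contains every open cover. -/
def IsSupercomplete [TopologicalSpace X] (μ : PreUniformity X) : Prop :=
  ∀ G : Set (Set X), (∀ g ∈ G, IsOpen g) → ⋃₀ G = univ → G ∈ μ.covers

end PreUniformity

/-- A left-open partition of a space: a partition with a well-ordering of its members such that
all the unions of closed initial segments `⋃ {Q : Q ≤ P}` are open. -/
structure LeftOpenPartition (X : Type*) [TopologicalSpace X] where
  parts : Set (Set X)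
  isPartition : Setoid.IsPartition parts
  lt : parts → parts → Prop
  isWellOrder : IsWellOrder parts lt
  isOpen_initial : ∀ P : parts, IsOpen (⋃ Q ∈ {Q : parts | Q = P ∨ lt Q P}, (Q : Set X))

/-- A sequence of left-open partitions is complete if each refines the preceding one, the
well-orders are compatible, and every filter that contains a member of each of the partitions has
a cluster point. -/
structure LeftOpenPartition.IsComplete {X : Type*} [TopologicalSpace X]
    (Ps : ℕ → LeftOpenPartition X) : Prop where
  refines : ∀ n, Refines (Ps (n + 1)).parts (Ps n).parts
  compatible : ∀ n (P P' : (Ps n).parts) (Q Q' : (Ps (n + 1)).parts),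
    (Q : Set X) ⊆ P → (Q' : Set X) ⊆ P' → (Ps (n + 1)).lt Q Q' → P = P' ∨ (Ps n).lt P P'
  exists_clusterPt : ∀ f : Filter X, f.NeBot → (∀ n, ∃ P ∈ (Ps n).parts, P ∈ f) →
    ∃ x, ClusterPt x f

/-- A space is partition-complete if it has a complete sequence of left-open partitions. -/
def PartitionComplete (X : Type*) [TopologicalSpace X] : Prop :=
  ∃ Ps : ℕ → LeftOpenPartition X, LeftOpenPartition.IsComplete Ps

/-- A space is σ-partition-complete if it is the union of countably many closed subspaces that are
partition-complete. -/
def SigmaPartitionComplete (X : Type*) [TopologicalSpace X] : Prop :=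
  ∃ F : ℕ → Set X, (∀ n, IsClosed (F n)) ∧ ⋃ n, F n = univ ∧ ∀ n, PartitionComplete (F n)

open Topology Filter

namespace PreUniformity

/-! ### Members of the modified pre-uniformities, and uniformity on a subset. -/

section Basic

variable {X : Type*}

/-! Suppose an open cover `G` is missing, and call a set bad if `G` is not uniform on it. Every
`ν`-cover cuts a bad set into pieces one of which is bad, so a bad set can be shrunk: first over one
of the closed sets covering a factor, then, by the well-ordering of a left-open partition and
regularity, until its bad support in that factor lies in one part (`exists_badSupport_subset_part`).

These are countably many demands, so one filter of bad sets meets them all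
(`exists_filter_of_dense`), and a minimal filter below it still has only bad members. Completeness
yields in each factor a point common to all bad supports (`exists_forall_mem_badSupport`);
minimality makes the filter converge to the point with these coordinates (`mem_of_minimal`). A
member of `G` around the limit then belongs to the filter, yet it is not bad. -/

theorem subset_generate {S : Set (Set (Set X))} (hS : ∀ U ∈ S, ⋃₀ U = univ) :
    S ⊆ (generate S).covers :=
  fun U hU => ⟨hS U hU, fun _ h => h hU⟩

theorem preimage_mem_pi {ι : Type*} {X : ι → Type*} (μ : ∀ i, PreUniformity (X i)) (i : ι)
    {U : Set (Set (X i))} (hU : U ∈ (μ i).covers) :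
    (fun u => (fun x : ∀ i, X i => x i) ⁻¹' u) '' U ∈ (pi μ).covers := by
  refine subset_generate ?_ ⟨i, U, hU, rfl⟩
  rintro _ ⟨j, V, hV, rfl⟩
  refine eq_univ_of_forall fun x => ?_
  obtain ⟨v, hv, hx⟩ : x j ∈ ⋃₀ V := (μ j).isCover V hV ▸ mem_univ _
  exact ⟨_, mem_image_of_mem _ hv, hx⟩

theorem subset_metricFine [TopologicalSpace X] (μ : PreUniformity X) :
    μ.covers ⊆ μ.metricFine.covers :=
  fun U hU => ⟨U, μ.isCover U hU, fun u hu => ⟨u, hu, Subset.rfl⟩, fun _ => univ,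
    fun _ => isClosed_univ, iUnion_const _, fun _ => ⟨U, hU, fun u hu => ⟨u, hu, Subset.rfl⟩⟩⟩

/-- Every countable closed cover belongs to the metric-fine modification. -/
theorem range_mem_metricFine [TopologicalSpace X] (μ : PreUniformity X) {F : ℕ → Set X}
    (hF : ∀ n, IsClosed (F n)) (hFu : ⋃ n, F n = univ) :
    range F ∈ μ.metricFine.covers := by
  refine ⟨range F, by rwa [sUnion_range], fun u hu => ⟨u, hu, Subset.rfl⟩, F, hF, hFu,
    fun n => ⟨{univ}, μ.univ_mem, ?_⟩⟩
  rintro _ ⟨u, -, rfl⟩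
  exact ⟨_, mem_image_of_mem _ (mem_range_self n), fun x hx => ⟨hx.2, hx.2⟩⟩

/-- The family `G` is `ν`-uniform on `A`: the trace on `A` of some member of `ν` refines `G`. -/
def UniformOn (ν : PreUniformity X) (G : Set (Set X)) (A : Set X) : Prop :=
  ∃ U ∈ ν.covers, ∀ u ∈ U, ∃ g ∈ G, A ∩ u ⊆ g

variable {ν : PreUniformity X} {G : Set (Set X)} {A B : Set X}

theorem uniformOn_univ : ν.UniformOn G univ ↔ G ∈ ν.covers := by
  refine ⟨fun ⟨U, hU, h⟩ => ν.of_refines U hU G fun u hu => ?_, fun h => ⟨G, h, fun u hu => ?_⟩⟩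
  · simpa using h u hu
  · exact ⟨u, hu, inter_subset_right⟩

theorem UniformOn.mono (hB : ν.UniformOn G B) (h : A ⊆ B) : ν.UniformOn G A := by
  obtain ⟨U, hU, hG⟩ := hB
  refine ⟨U, hU, fun u hu => ?_⟩
  obtain ⟨g, hg, hs⟩ := hG u hu
  exact ⟨g, hg, (inter_subset_inter_left u h).trans hs⟩

theorem uniformOn_of_subset {g : Set X} (hg : g ∈ G) (h : A ⊆ g) : ν.UniformOn G A :=
  ⟨{univ}, ν.univ_mem, fun _ _ => ⟨g, hg, inter_subset_left.trans h⟩⟩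

/-- Local fineness is applied only here: the covers witnessing uniformity on the pieces subdivide
`U` into a single witness on `A`. Contrapositively, a bad set has a bad piece in every `ν`-cover. -/
theorem IsLocallyFine.uniformOn (hν : ν.IsLocallyFine) {U : Set (Set X)} (hU : U ∈ ν.covers)
    (h : ∀ u ∈ U, ν.UniformOn G (A ∩ u)) : ν.UniformOn G A := by
  have h' : ∀ u, ∃ V, u ∈ U → V ∈ ν.covers ∧ ∀ v ∈ V, ∃ g ∈ G, A ∩ u ∩ v ⊆ g := by
    intro u
    by_cases hu : u ∈ U
    · obtain ⟨V, hV⟩ := h u hu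
      exact ⟨V, fun _ => hV⟩
    · exact ⟨∅, fun hu' => absurd hu' hu⟩
  choose V hV using h'
  refine ⟨subdivide U V, hν U hU V fun u hu => (hV u hu).1, ?_⟩
  rintro _ ⟨u, hu, v, hv, rfl⟩
  obtain ⟨g, hg, hs⟩ := (hV u hu).2 v hv
  exact ⟨g, hg, by rwa [← inter_assoc]⟩

end Basic

/-! ### Bad supports in a factor, and shrinking them into one part. -/

section Support

variable {X Y : Type*} [TopologicalSpace Y] {ν : PreUniformity X} {G : Set (Set X)} {π : X → Y}
  {A B : Set X}

/-- The set of the points of `Y` over whose neighbourhoods the family `G` is never `ν`-uniform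
on `A`. -/
def badSupport (ν : PreUniformity X) (G : Set (Set X)) (π : X → Y) (A : Set X) : Set Y :=
  {y | ∀ V, IsOpen V → y ∈ V → ¬ ν.UniformOn G (A ∩ π ⁻¹' V)}

theorem notMem_badSupport {y : Y} :
    y ∉ badSupport ν G π A ↔ ∃ V, IsOpen V ∧ y ∈ V ∧ ν.UniformOn G (A ∩ π ⁻¹' V) := by
  simp [badSupport]

theorem badSupport_mono (h : A ⊆ B) : badSupport ν G π A ⊆ badSupport ν G π B :=
  fun _ hy V hV hyV hB => hy V hV hyV (hB.mono (inter_subset_inter_left _ h))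

theorem isClosed_badSupport : IsClosed (badSupport ν G π A) := by
  rw [← isOpen_compl_iff, isOpen_iff_forall_mem_open]
  intro y hy
  obtain ⟨V, hV, hyV, h⟩ := notMem_badSupport.1 hy
  exact ⟨V, fun z hz => notMem_badSupport.2 ⟨V, hV, hz, h⟩, hV, hyV⟩

/-- The map `π` pulls the open covers of `Y` back to members of `ν`. -/
def PullsBackOpenCovers (ν : PreUniformity X) (π : X → Y) : Prop :=
  ∀ W : Set (Set Y), (∀ w ∈ W, IsOpen w) → ⋃₀ W = univ → preimage π '' W ∈ ν.covers

theorem PullsBackOpenCovers.uniformOn (hπ : ν.PullsBackOpenCovers π) (hν : ν.IsLocallyFine)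
    (h : ∀ y, ∃ V, IsOpen V ∧ y ∈ V ∧ ν.UniformOn G (A ∩ π ⁻¹' V)) : ν.UniformOn G A := by
  choose V hV hyV hU using h
  refine hν.uniformOn (hπ (range V) ?_ ?_) ?_
  · rintro _ ⟨y, rfl⟩
    exact hV y
  · exact eq_univ_of_forall fun y => ⟨V y, mem_range_self y, hyV y⟩
  · rintro _ ⟨_, ⟨y, rfl⟩, rfl⟩
    exact hU y

theorem nonempty_badSupport (hπ : ν.PullsBackOpenCovers π) (hν : ν.IsLocallyFine)
    (hA : ¬ ν.UniformOn G A) : (badSupport ν G π A).Nonempty := by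
  by_contra h
  exact hA (hπ.uniformOn hν fun y => notMem_badSupport.1 fun hy => h ⟨y, hy⟩)

/-- In a set on which `G` is not uniform and which lies over a closed set with a left-open
partition there is a smaller such set whose bad support lies in one part. -/
theorem exists_badSupport_subset_part [RegularSpace Y] (hπ : ν.PullsBackOpenCovers π)
    (hν : ν.IsLocallyFine) (hG : G.Nonempty) {F : Set Y} (hF : IsClosed F)
    (P : LeftOpenPartition F) (hA : ¬ ν.UniformOn G A) (hAF : A ⊆ π ⁻¹' F) :
    ∃ B ⊆ A, ¬ ν.UniformOn G B ∧ ∃ p ∈ P.parts, badSupport ν G π B ⊆ (↑) '' p := by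
  obtain ⟨g, hg⟩ := hG
  have hwf : WellFounded P.lt := P.isWellOrder.wf
  have hdisj : ∀ C : Set X, C = ∅ → ν.UniformOn G C := fun C hC =>
    uniformOn_of_subset hg (hC ▸ empty_subset g)
  -- The closure keeps points of `F` beyond the initial segment of `p` away from `W`, so the bad
  -- support over `W` stays in that segment. The least `p` in `S` is the part sought.
  let S : Set P.parts := {p | ∃ W : Set Y, IsOpen W ∧
    (∀ y : F, (y : Y) ∈ closure W → y ∈ ⋃ q ∈ {q : P.parts | q = p ∨ P.lt q p}, (q : Set F)) ∧
    ¬ ν.UniformOn G (A ∩ π ⁻¹' W)}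
  have hpart : ∀ y : F, ∃ p : P.parts, y ∈ (p : Set F) := fun y => by
    obtain ⟨p, ⟨hp, hy⟩, -⟩ := P.isPartition.2 y
    exact ⟨⟨p, hp⟩, hy⟩
  have hnhd : ∀ (y : F) (p : P.parts), y ∈ (p : Set F) → ∃ W : Set Y, IsOpen W ∧ (y : Y) ∈ W ∧
      ∀ z : F, (z : Y) ∈ closure W →
        z ∈ ⋃ q ∈ {q : P.parts | q = p ∨ P.lt q p}, (q : Set F) := by
    intro y p hy
    obtain ⟨O, hO, hOe⟩ := isOpen_induced_iff.1 (P.isOpen_initial p)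
    have hyO : (y : Y) ∈ O := by
      have : y ∈ (↑) ⁻¹' O := by
        rw [hOe]
        exact mem_biUnion (Or.inl rfl : p ∈ {q | q = p ∨ P.lt q p}) hy
      exact this
    obtain ⟨K, ⟨hK, hKc⟩, hKO⟩ := (closed_nhds_basis (y : Y)).mem_iff.1 (hO.mem_nhds hyO)
    refine ⟨interior K, isOpen_interior, mem_interior_iff_mem_nhds.2 hK, fun z hz => ?_⟩
    rw [← hOe]
    exact hKO (closure_minimal interior_subset hKc hz)
  have hS : S.Nonempty := by
    by_contra hS
    refine hA (hπ.uniformOn hν fun y => ?_)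
    by_cases hy : y ∈ F
    · obtain ⟨p, hp⟩ := hpart ⟨y, hy⟩
      obtain ⟨W, hW, hyW, hcl⟩ := hnhd _ p hp
      refine ⟨W, hW, hyW, ?_⟩
      by_contra hbad
      exact hS ⟨p, W, hW, hcl, hbad⟩
    · refine ⟨Fᶜ, hF.isOpen_compl, hy, hdisj _ ?_⟩
      exact eq_empty_of_forall_notMem fun x hx => hx.2 (hAF hx.1)
  obtain ⟨W, hW, hcl, hbad⟩ := hwf.min_mem S hS
  refine ⟨A ∩ π ⁻¹' W, inter_subset_left, hbad, hwf.min S hS, (hwf.min S hS).2, fun y hy => ?_⟩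
  by_contra hyp
  refine notMem_badSupport.2 ?_ hy
  by_cases hyF : y ∈ F
  swap
  · refine ⟨Fᶜ, hF.isOpen_compl, hyF, hdisj _ ?_⟩
    exact eq_empty_of_forall_notMem fun x hx => hx.2 (hAF hx.1.1)
  by_cases hyW : y ∈ closure W
  swap
  · refine ⟨(closure W)ᶜ, isClosed_closure.isOpen_compl, hyW, hdisj _ ?_⟩
    exact eq_empty_of_forall_notMem fun x hx => hx.2 (subset_closure hx.1.2)
  obtain ⟨q, hq, hyq⟩ := mem_iUnion₂.1 (hcl ⟨y, hyF⟩ hyW)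
  have hlt : P.lt q (hwf.min S hS) := by
    rcases hq with rfl | hq
    · exact absurd ⟨_, hyq, rfl⟩ hyp
    · exact hq
  obtain ⟨V, hV, hyV, hclV⟩ := hnhd _ q hyq
  refine ⟨V, hV, hyV, ?_⟩
  by_contra hbad'
  -- If `G` were not uniform over `W ∩ V`, this set would put the earlier part `q` into `S`.
  refine hwf.not_lt_min S (x := q) ⟨W ∩ V, hW.inter hV, fun z hz => ?_, ?_⟩ hlt
  · exact hclV z (closure_mono inter_subset_right hz)
  · rwa [preimage_inter, ← inter_assoc]

end Support

/-! ### Minimal filters and filters meeting countably many dense families. -/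

section Generic

variable {X : Type*}

/-- Let `f` be minimal among the filters whose members all have the property `p`. If the traces of
the members of `f` on `V` have the property `p`, then `V` belongs to `f`. -/
theorem mem_of_minimal {p : Set X → Prop} (hp : ∀ A B, A ⊆ B → p A → p B) {f : Filter X}
    (hf : Minimal (fun f : Filter X => ∀ A ∈ f, p A) f) {V : Set X}
    (hV : ∀ A ∈ f, p (A ∩ V)) : V ∈ f := by
  -- Each member of `f ⊓ 𝓟 V` contains the trace on `V` of a member of `f`, hence has the property
  -- `p`.
  have h : f ≤ f ⊓ 𝓟 V := by
    refine hf.2 (fun A hA => ?_) inf_le_left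
    rw [mem_inf_principal] at hA
    exact hp _ _ (fun x hx => hx.1 hx.2) (hV _ hA)
  exact le_principal_iff.1 (h.trans inf_le_right)

/-- Zorn's lemma in the reversed order: a chain is directed, so each member of its infimum already
belongs to one of its filters. -/
theorem exists_minimal_le {p : Set X → Prop} {f₀ : Filter X} (hf₀ : ∀ A ∈ f₀, p A) :
    ∃ f ≤ f₀, Minimal (fun f : Filter X => ∀ A ∈ f, p A) f := by
  refine zorn_le_nonempty₀ (α := (Filter X)ᵒᵈ) {f | ∀ A ∈ OrderDual.ofDual f, p A}
    (fun c hc hchain y hy => ?_) f₀ hf₀ |>.imp fun f hf => ⟨hf.1, hf.2⟩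
  refine ⟨OrderDual.toDual (sInf (OrderDual.ofDual '' c)), fun A hA => ?_,
    fun z hz => sInf_le (mem_image_of_mem OrderDual.ofDual hz)⟩
  have hdir : DirectedOn (· ≥ ·) (OrderDual.ofDual '' c) := by
    rintro _ ⟨a, ha, rfl⟩ _ ⟨b, hb, rfl⟩
    obtain ⟨d, hd, h₁, h₂⟩ := hchain.directedOn a ha b hb
    exact ⟨_, ⟨d, hd, rfl⟩, h₁, h₂⟩
  rw [OrderDual.ofDual_toDual, sInf_eq_iInf, mem_biInf_of_directed hdir ⟨y, y, hy, rfl⟩] at hA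
  obtain ⟨_, ⟨a, ha, rfl⟩, hAa⟩ := hA
  exact hc ha A hAa

/-- Given countably many dense families of sets with the property `p`, there is a filter with a
base of such sets that meets all these families. -/
theorem exists_filter_of_dense {p : Set X → Prop} (hp : ∀ A B, A ⊆ B → p A → p B) (hX : p univ)
    {ι : Type*} [Countable ι] (D : ι → Set (Set X))
    (hD : ∀ i A, p A → ∃ B ⊆ A, p B ∧ B ∈ D i) :
    ∃ f : Filter X, (∀ A ∈ f, p A) ∧ ∀ i, ∃ A ∈ f, A ∈ D i := by
  have := Encodable.ofCountable ι
  -- Rasiowa–Sikorski: with smaller sets as larger conditions, the generic ideal is a filter base.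
  let Q := {A : Set X // p A}ᵒᵈ
  let C : ι → Order.Cofinal Q := fun i =>
    { carrier := {A | (OrderDual.ofDual A).1 ∈ D i}
      isCofinal := fun A => by
        obtain ⟨B, hBA, hB, hBD⟩ := hD i _ (OrderDual.ofDual A).2
        exact ⟨OrderDual.toDual ⟨B, hB⟩, hBD, hBA⟩ }
  let I := Order.idealOfCofinals (OrderDual.toDual ⟨univ, hX⟩ : Q) C
  refine ⟨⟨{A | ∃ B ∈ I, (OrderDual.ofDual B).1 ⊆ A}, ?_, ?_, ?_⟩, ?_, fun i => ?_⟩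
  · obtain ⟨B, hB⟩ := I.nonempty
    exact ⟨B, hB, subset_univ _⟩
  · rintro A A' ⟨B, hB, h⟩ hA
    exact ⟨B, hB, h.trans hA⟩
  · rintro A A' ⟨B, hB, h⟩ ⟨B', hB', h'⟩
    obtain ⟨E, hE, h₁, h₂⟩ := I.directed B hB B' hB'
    exact ⟨E, hE, subset_inter (Subset.trans h₁ h) (Subset.trans h₂ h')⟩
  · rintro A ⟨B, -, h⟩
    exact hp _ _ h (OrderDual.ofDual B).2
  · obtain ⟨B, hBD, hB⟩ := Order.cofinal_meets_idealOfCofinals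
      (OrderDual.toDual ⟨univ, hX⟩ : Q) C i
    exact ⟨_, ⟨B, hB, Subset.rfl⟩, hBD⟩

end Generic

/-! ### Limits of filters of bad sets, and the product theorem. -/

/-- If the bad supports of the members of a filter get into a part of each of the partitions of a
complete sequence on a closed set, then they have a common point. -/
theorem exists_forall_mem_badSupport {X Y : Type*} [TopologicalSpace Y] {ν : PreUniformity X}
    {G : Set (Set X)} {π : X → Y} (hπ : ν.PullsBackOpenCovers π) (hν : ν.IsLocallyFine)
    {F : Set Y} {P : ℕ → LeftOpenPartition F} (hP : LeftOpenPartition.IsComplete P)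
    {f : Filter X} (hf : ∀ A ∈ f, ¬ ν.UniformOn G A)
    (h : ∀ k, ∃ A ∈ f, ∃ p ∈ (P k).parts, badSupport ν G π A ⊆ (↑) '' p) :
    ∃ y, ∀ A ∈ f, y ∈ badSupport ν G π A := by
  let e : Filter F := f.lift' fun A => (↑) ⁻¹' badSupport ν G π A
  have hmono : Monotone fun A => ((↑) : F → Y) ⁻¹' badSupport ν G π A :=
    fun A B hAB => preimage_mono (badSupport_mono hAB)
  have he : ∀ A ∈ f, (↑) ⁻¹' badSupport ν G π A ∈ e := fun A hA => mem_lift' hA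
  obtain ⟨A₀, hA₀, p₀, -, hs₀⟩ := h 0
  have hne : e.NeBot := by
    refine (lift'_neBot_iff hmono).2 fun A hA => ?_
    -- Intersecting with `A₀` forces the bad support into `F`, so its trace there is non-empty.
    obtain ⟨y, hy⟩ := nonempty_badSupport hπ hν (hf _ (Filter.inter_mem hA hA₀))
    obtain ⟨z, -, rfl⟩ := hs₀ (badSupport_mono inter_subset_right hy)
    exact ⟨z, badSupport_mono inter_subset_left hy⟩
  obtain ⟨y, hy⟩ := hP.exists_clusterPt e hne fun k => by
    obtain ⟨A, hA, p, hp, hs⟩ := h k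
    refine ⟨p, hp, mem_of_superset (he A hA) fun z hz => ?_⟩
    obtain ⟨z', hz', hzz⟩ := hs hz
    rwa [← Subtype.ext hzz]
  exact ⟨y, fun A hA => isClosed_iff_clusterPt.1
    (isClosed_badSupport.preimage continuous_subtype_val) y (hy.mono (le_principal_iff.2 (he A hA)))⟩

/-- A locally fine pre-uniformity on a countable product of σ-partition-complete regular spaces
is supercomplete if it contains the countable closed covers and the inverse images of the open
covers of the factors. -/
theorem IsLocallyFine.isSupercomplete_pi {ι : Type*} [Countable ι] {X : ι → Type*}
    [∀ i, TopologicalSpace (X i)] [∀ i, RegularSpace (X i)]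
    (hX : ∀ i, SigmaPartitionComplete (X i)) {ν : PreUniformity (∀ i, X i)}
    (hν : ν.IsLocallyFine) (hπ : ∀ i, ν.PullsBackOpenCovers fun x : ∀ i, X i => x i)
    (hc : ∀ F : ℕ → Set (∀ i, X i), (∀ n, IsClosed (F n)) → ⋃ n, F n = univ →
      range F ∈ ν.covers) :
    ν.IsSupercomplete := by
  intro G hGo hGc
  rw [← uniformOn_univ]
  by_contra hbad
  -- A point of the product makes `G` non-empty, hence uniform on the empty set.
  obtain ⟨x₀⟩ : Nonempty (∀ i, X i) := by
    by_contra hem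
    obtain ⟨i, hi⟩ : ∃ i, IsEmpty (X i) := by
      simpa [Classical.nonempty_pi] using hem
    exact hbad ((hπ i).uniformOn hν fun y => (hi.false y).elim)
  have hG : G.Nonempty := by
    obtain ⟨g, hg, -⟩ : x₀ ∈ ⋃₀ G := hGc ▸ mem_univ x₀
    exact ⟨g, hg⟩
  choose F hFc hFu hFp using hX
  choose P hP using hFp
  have hmono : ∀ A B : Set (∀ i, X i), A ⊆ B → ¬ ν.UniformOn G A → ¬ ν.UniformOn G B :=
    fun A B hAB hA hB => hA (hB.mono hAB)
  -- The `m` to be chosen for a coordinate is not known beforehand, so every `m` gets its families;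
  -- the first alternative keeps them dense when no bad subset lies over `F i m`.
  obtain ⟨f₀, hf₀, hD⟩ := exists_filter_of_dense hmono hbad
    (ι := ι ⊕ ι × ℕ × ℕ) (Sum.elim (fun i => {A | ∃ m, A ⊆ (fun x => x i) ⁻¹' F i m})
      fun t => {A | (∀ B ⊆ A, ¬ ν.UniformOn G B → ¬ B ⊆ (fun x => x t.1) ⁻¹' F t.1 t.2.1) ∨
        ∃ p ∈ (P t.1 t.2.1 t.2.2).parts,
          badSupport ν G (fun x : ∀ i, X i => x t.1) A ⊆ (↑) '' p}) (by
    rintro (i | ⟨i, m, k⟩) A hA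
    · have h : ∃ m, ¬ ν.UniformOn G (A ∩ (fun x => x i) ⁻¹' F i m) := by
        by_contra! h
        refine hA (hν.uniformOn (hc (fun m => (fun x => x i) ⁻¹' F i m)
          (fun m => (hFc i m).preimage (continuous_apply i)) ?_) ?_)
        · rw [← preimage_iUnion, hFu, preimage_univ]
        · rintro _ ⟨m, rfl⟩
          exact h m
      obtain ⟨m, hm⟩ := h
      exact ⟨_, inter_subset_left, hm, m, inter_subset_right⟩
    · by_cases h : ∃ B ⊆ A, ¬ ν.UniformOn G B ∧ B ⊆ (fun x => x i) ⁻¹' F i m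
      · obtain ⟨B, hBA, hB, hBF⟩ := h
        obtain ⟨C, hCB, hC, hp⟩ := exists_badSupport_subset_part (hπ i) hν hG (hFc i m)
          (P i m k) hB hBF
        exact ⟨C, hCB.trans hBA, hC, Or.inr hp⟩
      · exact ⟨A, Subset.rfl, hA, Or.inl fun B hB hB' hBF => h ⟨B, hB, hB', hBF⟩⟩)
  obtain ⟨f, hff₀, hf⟩ := exists_minimal_le hf₀
  have hlim : ∀ i, ∃ y, ∀ A ∈ f, y ∈ badSupport ν G (fun x : ∀ i, X i => x i) A := by
    intro i
    obtain ⟨A, hA, m, hAm⟩ := hD (Sum.inl i)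
    refine exists_forall_mem_badSupport (hπ i) hν (hP i m) hf.1 fun k => ?_
    obtain ⟨B, hB, h | h⟩ := hD (Sum.inr (i, m, k))
    -- The set `A ∩ B` is bad and lies over `F i m`, which excludes the first alternative.
    · exact absurd (inter_subset_left.trans hAm)
        (h (A ∩ B) inter_subset_right (hf₀ _ (Filter.inter_mem hA hB)))
    · exact ⟨B, hff₀ hB, h⟩
  choose x hx using hlim
  have hfx : f ≤ 𝓝 x := by
    rw [nhds_pi]
    refine le_iInf fun i => ?_
    rw [← tendsto_iff_comap, tendsto_nhds]
    exact fun V hV hxV => mem_of_minimal hmono hf fun A hA => hx i A hA V hV hxV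
  obtain ⟨g, hg, hxg⟩ : x ∈ ⋃₀ G := hGc ▸ mem_univ x
  exact hf.1 g (hfx ((hGo g hg).mem_nhds hxg)) (uniformOn_of_subset hg Subset.rfl)

end PreUniformity

theorem theorem6p4 {X : ℕ → Type*} [∀ i, TopologicalSpace (X i)] [∀ i, RegularSpace (X i)]
    (hX : ∀ i, SigmaPartitionComplete (X i))
    (μ : ∀ i, PreUniformity (X i)) (hμ : ∀ i, (μ i).IsSupercomplete) :
    (PreUniformity.pi μ).metricFine.locallyFine.IsSupercomplete := by
  refine PreUniformity.IsLocallyFine.isSupercomplete_pi hX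
    (PreUniformity.isLocallyFine_locallyFine _) (fun i W hW hWc => ?_) fun F hF hFu => ?_
  · exact PreUniformity.le_locallyFine _ (PreUniformity.subset_metricFine _
      (PreUniformity.preimage_mem_pi μ i (hμ i W hW hWc)))
  · exact PreUniformity.le_locallyFine _ (PreUniformity.range_mem_metricFine _ hF hFu)
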